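/- Let $K\ge 0$, $J=K+4$, and let $0=\xi_0<\xi_1<\dots<\xi_{K+1}=1$ be knots. Let $B_1,\dots,B_J$ be the cubic B-splines on $[0,1]$ for these knots, with both boundary knots repeated four times, and let $f=\sum_{j=1}^J\gamma_jB_j$ be non-decreasing on $[0,1]$. Let $n\ge1$, $x_1,\dots,x_n\in[0,1]$, and $y_i=f(x_i)+\varepsilon_i$. Let $\hat f=\sum_j\hat\gamma_jB_j$, where $\hat\gamma$ minimizes $\sum_{i=1}^n\big(y_i-\sum_j\beta_jB_j(x_i)\big)^2$ over all $\beta\in\mathbb R^J$ with $\beta_1\le\dots\le\beta_J$. Assume that for real numbers $L,\eta_1,\eta_2$: (1) $|f''(t)|\le L$ for all $t\in[0,1]$; (2) each of the $K+1$ intervals $[\xi_k,\xi_{k+1})$ between adjacent knots (the last one closed on the right) contains at most $\frac{n}{K+1}(1+\eta_1)$ of the points $x_i$, counted with multiplicity; (3) $\xi_{k+1}-\xi_k\le\frac{1+\eta_2}{K+1}$ for $k=0,\dots,K$. Then the following holds. (a) No error. If $\varepsilon_i=0$ for all $i$, then $$\frac1n\sum_{i=1}^n\big(f(x_i)-\hat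 f(x_i)\big)^2\le\frac{36(1+\eta_1)(1+\eta_2)^2L^2J}{(J-3)^3},$$ and for fixed $L,\eta_1,\eta_2$ the right-hand side is $O(J^{-2})$ as $J\to\infty$. (b) Sub-Gaussian errors. Let $0<c\le C$. There is a number $N$, depending only on $c$ and $C$, such that the following holds for all $n\ge N$ and all $J$ with $c\,n^{1/3}\le J\le C\,n^{1/3}$; if $C\le1$, one can take $N=1$. Let $\varepsilon_1,\dots,\varepsilon_n$ be i.i.d. sub-Gaussian with parameter $\sigma>0$, that is, $\mathbb E e^{t\varepsilon_i}\le e^{\sigma^2t^2/2}$ for all $t\in\mathbb R$, and let $c_1>0$ be such that every eigenvalue of $\frac1n\mathbf B^T\mathbf B$ is at least $c_1/J$, where $\mathbf B=(B_j(x_i))_{i,j}$. Then for every $M\ge0$, with probability at least $1-2J^{-M^2}$, $$\frac1n\sum_{i=1}^n\big(f(x_i)-\hat f(x_i)\big)^2\le\frac{36(1+\eta_1)(1+\eta_2)^2L^2J}{(J-3)^3}+\frac{32}{c_1}\sigma^2(1+M)^2(1+\eta_1)\frac{\log J}{(J-3)^2},$$ and for fixed $L,\eta_1,\eta_2,c_1,\sigma,M$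 the right-hand side is $O(\log J/J^2)$ as $J\to\infty$. -/

import Mathlib

open Set Filter MeasureTheory ProbabilityTheory
open scoped NNReal

noncomputable section

namespace MonoSpline

/-- The augmented knot sequence of cubic splines with knots `ξ₀ < ξ₁ < ⋯ < ξ_{K+1}`: both boundary
knots are repeated four times.  The index starts at `0`, so `τ₀ = τ₁ = τ₂ = τ₃ = ξ₀`,
`τ_{k+3} = ξ_k` for `k ≤ K + 1`, and `τ_{K+4} = ⋯ = τ_{K+7} = ξ_{K+1}`.
(The truncated subtraction is intended.) -/
def augKnot {K : ℕ} (ξ : Fin (K + 2) → ℝ) (j : ℕ) : ℝ :=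
  ξ ⟨min (j - 3) (K + 1), by omega⟩

/-- B-splines by the Cox–de Boor recursion; `bspline ξ d i` has degree `d`, that is, order `d + 1`.
The last nonempty knot interval is closed on the right, so that the basis functions are
continuous on the whole closed interval `[ξ₀, ξ_{K+1}]`.  Quotients with a vanishing denominator
are read as `0`, as usual. -/
def bspline {K : ℕ} (ξ : Fin (K + 2) → ℝ) : ℕ → ℕ → ℝ → ℝ
  | 0, i, x =>
      open Classical in
      if (augKnot ξ i ≤ x ∧ x < augKnot ξ (i + 1)) ∨
          (augKnot ξ i < x ∧ x = augKnot ξ (i + 1) ∧ x = ξ (Fin.last (K + 1)))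
      then 1 else 0
  | d + 1, i, x =>
      (x - augKnot ξ i) / (augKnot ξ (i + d + 1) - augKnot ξ i) * bspline ξ d i x +
        (augKnot ξ (i + d + 2) - x) / (augKnot ξ (i + d + 2) - augKnot ξ (i + 1)) *
          bspline ξ d (i + 1) x

/-- The spline `f(x) = ∑_j γ_j B_j(x)` in the `J = K + 4` cubic B-splines. -/
def spline {K : ℕ} (ξ : Fin (K + 2) → ℝ) (γ : Fin (K + 4) → ℝ) (x : ℝ) : ℝ :=
  ∑ j : Fin (K + 4), γ j * bspline ξ 3 (j : ℕ) x

/-- The design matrix `𝐁_{ij} = B_j(x_i)`. -/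
def designMatrix {K n : ℕ} (ξ : Fin (K + 2) → ℝ) (x : Fin n → ℝ) :
    Matrix (Fin n) (Fin (K + 4)) ℝ :=
  Matrix.of fun i j => bspline ξ 3 (j : ℕ) (x i)

/-- The normalized Gram matrix `(1/n) 𝐁ᵀ𝐁`. -/
def gramMatrix {K n : ℕ} (ξ : Fin (K + 2) → ℝ) (x : Fin n → ℝ) :
    Matrix (Fin (K + 4)) (Fin (K + 4)) ℝ :=
  (1 / (n : ℝ)) • ((designMatrix ξ x).transpose * designMatrix ξ x)

/-- Residual sum of squares `(𝐲 - 𝐁β)ᵀ(𝐲 - 𝐁β)`. -/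
def rss {K n : ℕ} (ξ : Fin (K + 2) → ℝ) (x y : Fin n → ℝ) (β : Fin (K + 4) → ℝ) : ℝ :=
  ∑ i : Fin n, (y i - spline ξ β (x i)) ^ 2

/-- `γhat` solves the least-squares problem under the constraint `γ₁ ≤ ⋯ ≤ γ_J`. -/
def IsMonotoneFit {K n : ℕ} (ξ : Fin (K + 2) → ℝ) (x y : Fin n → ℝ)
    (γhat : Fin (K + 4) → ℝ) : Prop :=
  Monotone γhat ∧ ∀ β : Fin (K + 4) → ℝ, Monotone β → rss ξ x y γhat ≤ rss ξ x y β

/-- In-sample mean squared error `(1/n) ∑_i (f(x_i) - fhat(x_i))²`. -/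
def mse {K n : ℕ} (ξ : Fin (K + 2) → ℝ) (x : Fin n → ℝ) (γ γhat : Fin (K + 4) → ℝ) : ℝ :=
  (1 / (n : ℝ)) * ∑ i : Fin n, (spline ξ γ (x i) - spline ξ γhat (x i)) ^ 2

/-- The `k`-th cell between adjacent knots: `[ξ_k, ξ_{k+1})`, closed on the right for the last
one, so that the cells partition `[ξ₀, ξ_{K+1}]`. -/
def cell {K : ℕ} (ξ : Fin (K + 2) → ℝ) (k : Fin (K + 1)) : Set ℝ :=
  {t | ξ k.castSucc ≤ t ∧ (t < ξ k.succ ∨ (k = Fin.last K ∧ t = ξ k.succ))}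

/-- The standing assumptions on the knots, the design points and the regression function. -/
structure Setup {K n : ℕ} (L η₁ η₂ : ℝ) (ξ : Fin (K + 2) → ℝ) (x : Fin n → ℝ)
    (γ : Fin (K + 4) → ℝ) : Prop where
  /-- The knots satisfy `0 = ξ₀ < ξ₁ < ⋯ < ξ_{K+1} = 1`. -/
  knots_strictMono : StrictMono ξ
  knots_zero : ξ 0 = 0
  knots_last : ξ (Fin.last (K + 1)) = 1
  /-- The design points lie in `[0, 1]`. -/
  design_mem : ∀ i, x i ∈ Icc (0 : ℝ) 1
  /-- The spline `f` is non-decreasing on `[0, 1]`. -/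
  monotone : MonotoneOn (spline ξ γ) (Icc 0 1)
  /-- Bounded second derivative. -/
  second_deriv : ∀ t ∈ Icc (0 : ℝ) 1, |iteratedDerivWithin 2 (spline ξ γ) (Icc 0 1) t| ≤ L
  /-- Nearly uniform design points: at most `n/(K+1) (1+η₁)` in each cell. -/
  design_count : ∀ k : Fin (K + 1),
    (Nat.card {i : Fin n // x i ∈ cell ξ k} : ℝ) ≤ (n : ℝ) / ((K : ℝ) + 1) * (1 + η₁)
  /-- Nearly equally spaced knots. -/
  knots_spacing : ∀ k : Fin (K + 1), ξ k.succ - ξ k.castSucc ≤ (1 + η₂) / ((K : ℝ) + 1)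

/-- `36 (1+η₁)(1+η₂)² L² J / (J-3)³`. -/
def approxBound (L η₁ η₂ : ℝ) (J : ℕ) : ℝ :=
  36 * (1 + η₁) * (1 + η₂) ^ 2 * L ^ 2 * (J : ℝ) / ((J : ℝ) - 3) ^ 3

/-- `(32/c₁) σ² (1+M)² (1+η₁) log J / (J-3)²`. -/
def noiseBound (c₁ σ M η₁ : ℝ) (J : ℕ) : ℝ :=
  32 / c₁ * σ ^ 2 * (1 + M) ^ 2 * (1 + η₁) * (Real.log (J : ℝ) / ((J : ℝ) - 3) ^ 2)

end MonoSpline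

end

namespace MonoSpline

/-! ### B-splines: sign, support, partition of unity, reproduction of linear functions. -/

section Bspline

variable {K : ℕ} {ξ : Fin (K + 2) → ℝ}

/-! The coefficients of a non-decreasing spline `f` need not be monotone, so `f` itself may be
infeasible in the least-squares problem. A feasible substitute is Schoenberg's operator: take the
values of `f` at the knot averages as coefficients. They are non-decreasing because `f` is. Since
the B-splines are non-negative, sum to one and reproduce linear functions, the error of this spline
at a point is a weighted mean of second-order Taylor remainders of `f`, hence at most `2 L h` for
knot spacing at most `h` (`Setup.abs_spline_sub_schoenberg_le`). Without noise, minimality of the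
fit finishes the proof.

With noise, the fit is a projection onto a convex set, and its variational inequality gives `‖f -
fhat‖² ≤ ‖f - β‖² + 2⟨e, v⟩ - ‖v‖²`, where `β` is the substitute and `v = fhat - β` lies in the
linear space of splines sampled at the design points (`IsMonotoneFit.sum_sq_le`). The last two terms
are at most the squared norm of the projection of the noise on that space, of dimension at most `J`.
The exponential moment of this quadratic form is bounded by Gaussian linearization
(`lintegral_exp_sum_sq_le`), and Markov's inequality gives a level of order `σ² (J + M² log J) / n`.
The relation between `n` and `J` turns it into the stated bound, where `c₁` enters through `c₁ ≤ 1`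
and the design count through `η₁ ≥ 0`. -/

theorem augKnot_mono (hξ : Monotone ξ) : Monotone (augKnot ξ) := fun i j hij =>
  hξ (Fin.mk_le_mk.2 (by omega))

/-- A B-spline whose support interval is degenerate vanishes. -/
theorem bspline_eq_zero_of_knots_eq (d i : ℕ) (x : ℝ)
    (hξ : Monotone ξ) (h : augKnot ξ (i + d + 1) = augKnot ξ i) : bspline ξ d i x = 0 := by
  have hm := augKnot_mono hξ
  cases d with
  | zero =>
    simp only [bspline]
    rw [if_neg]
    simp only [add_zero] at h
    rw [h]
    rintro (⟨h1, h2⟩ | ⟨h1, h2, -⟩) <;> linarith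
  | succ d =>
    have h1 : augKnot ξ (i + d + 1) = augKnot ξ i :=
      le_antisymm (h ▸ hm (by omega)) (hm (by omega))
    have h2 : augKnot ξ (i + d + 2) = augKnot ξ (i + 1) :=
      le_antisymm ((show augKnot ξ (i + d + 2) = augKnot ξ i from h) ▸ hm (by omega))
        (hm (by omega))
    simp [bspline, h1, h2]

/-- Both claims go through one induction: the linear weights of the recursion are non-negative only
on the support of the B-spline they multiply. -/
theorem bspline_nonneg_and_support (hξ : Monotone ξ) (d i : ℕ) (x : ℝ) :
    0 ≤ bspline ξ d i x ∧
      (bspline ξ d i x ≠ 0 → augKnot ξ i ≤ x ∧ x ≤ augKnot ξ (i + d + 1)) := by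
  have hm := augKnot_mono hξ
  induction d generalizing i with
  | zero =>
    simp only [bspline, add_zero]
    split_ifs with h
    · refine ⟨zero_le_one, fun _ => ?_⟩
      rcases h with ⟨h1, h2⟩ | ⟨h1, h2, -⟩
      · exact ⟨h1, h2.le⟩
      · exact ⟨h1.le, h2.le⟩
    · simp
  | succ d ih =>
    obtain ⟨p1, s1⟩ := ih i
    obtain ⟨p2, s2⟩ := ih (i + 1)
    have e : i + 1 + d + 1 = i + d + 2 := by ring
    rw [e] at s2
    have m1 : augKnot ξ i ≤ augKnot ξ (i + 1) := hm (by omega)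
    have m2 : augKnot ξ (i + d + 1) ≤ augKnot ξ (i + d + 2) := hm (by omega)
    have m3 : augKnot ξ i ≤ augKnot ξ (i + d + 1) := hm (by omega)
    have m4 : augKnot ξ (i + 1) ≤ augKnot ξ (i + d + 2) := hm (by omega)
    constructor
    · simp only [bspline]
      apply add_nonneg
      · by_cases h : bspline ξ d i x = 0
        · simp [h]
        · exact mul_nonneg (div_nonneg (by linarith [(s1 h).1]) (by linarith)) p1
      · by_cases h : bspline ξ d (i + 1) x = 0
        · simp [h]
        · exact mul_nonneg (div_nonneg (by linarith [(s2 h).2]) (by linarith)) p2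
    · intro h
      rw [show i + (d + 1) + 1 = i + d + 2 by ring]
      by_cases h1 : bspline ξ d i x = 0
      · by_cases h2 : bspline ξ d (i + 1) x = 0
        · simp [bspline, h1, h2] at h
        · exact ⟨m1.trans (s2 h2).1, (s2 h2).2⟩
      · exact ⟨(s1 h1).1, (s1 h1).2.trans m2⟩

theorem bspline_nonneg (hξ : Monotone ξ) (d i : ℕ) (x : ℝ) : 0 ≤ bspline ξ d i x :=
  (bspline_nonneg_and_support hξ d i x).1

theorem augKnot_of_le (i : ℕ) (hi : i ≤ 3) : augKnot ξ i = ξ 0 := by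
  unfold augKnot
  congr 1
  ext
  simp
  omega

theorem augKnot_of_ge (i : ℕ) (hi : K + 4 ≤ i) : augKnot ξ i = ξ (Fin.last (K + 1)) := by
  unfold augKnot
  congr 1
  ext
  simp
  omega

theorem augKnot_castSucc (k : Fin (K + 1)) : augKnot ξ (k + 3) = ξ k.castSucc := by
  unfold augKnot
  congr 1
  ext
  simp

theorem augKnot_succ (k : Fin (K + 1)) : augKnot ξ (k + 4) = ξ k.succ := by
  unfold augKnot
  congr 1
  ext
  simp
  omega

/-- One step of the de Boor recursion for the coefficients of a spline. -/
theorem sum_bspline_succ (hξ : Monotone ξ) (d : ℕ) (hd : d ≤ 2) (a : ℕ → ℝ) (x : ℝ) :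
    ∑ i ∈ Finset.range (K + 4), a (i + 1) * bspline ξ (d + 1) i x =
      ∑ i ∈ Finset.range (K + 4),
        (a (i + 1) * (x - augKnot ξ i) + a i * (augKnot ξ (i + d + 1) - x)) /
          (augKnot ξ (i + d + 1) - augKnot ξ i) * bspline ξ d i x := by
  have z0 : bspline ξ d 0 x = 0 := bspline_eq_zero_of_knots_eq d 0 x hξ (by
    rw [augKnot_of_le _ (by omega), augKnot_of_le _ (by omega)])
  have z1 : bspline ξ d (K + 4) x = 0 := bspline_eq_zero_of_knots_eq d _ x hξ (by
    rw [augKnot_of_ge _ (by omega), augKnot_of_ge _ (by omega)])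
  let u : ℕ → ℝ := fun i => a i * ((augKnot ξ (i + d + 1) - x) /
    (augKnot ξ (i + d + 1) - augKnot ξ i) * bspline ξ d i x)
  -- An index shift. The two boundary terms vanish because boundary knots are repeated four times
  -- and `d ≤ 2`.
  have key : ∑ i ∈ Finset.range (K + 4), u (i + 1) = ∑ i ∈ Finset.range (K + 4), u i := by
    have h1 := Finset.sum_range_succ u (K + 4)
    have h2 := Finset.sum_range_succ' u (K + 4)
    have u0 : u 0 = 0 := by simp [u, z0]
    have u1 : u (K + 4) = 0 := by simp [u, z1]
    linarith
  have e1 : ∀ i, a (i + 1) * bspline ξ (d + 1) i x =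
      a (i + 1) * ((x - augKnot ξ i) / (augKnot ξ (i + d + 1) - augKnot ξ i) * bspline ξ d i x)
        + u (i + 1) := by
    intro i
    simp only [bspline, u]
    rw [show i + 1 + d + 1 = i + d + 2 by ring]
    ring
  simp only [e1]
  rw [Finset.sum_add_distrib, key, ← Finset.sum_add_distrib]
  refine Finset.sum_congr rfl fun i _ => ?_
  simp only [u]
  ring


theorem bspline_zero_of_mem_cell (hξ : StrictMono ξ) {k : Fin (K + 1)} {x : ℝ}
    (hx : x ∈ cell ξ k) (i : ℕ) :
    bspline ξ 0 i x = if i = k + 3 then 1 else 0 := by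
  have hm := augKnot_mono hξ.monotone
  simp only [bspline]
  obtain ⟨h1, h2⟩ := hx
  have hlt : ξ k.castSucc < ξ k.succ := hξ Fin.castSucc_lt_succ
  have hle : ξ k.succ ≤ ξ (Fin.last (K + 1)) := hξ.monotone (Fin.le_last _)
  have e1 := augKnot_castSucc (ξ := ξ) k
  have e2 := augKnot_succ (ξ := ξ) k
  rcases lt_trichotomy i (k + 3) with hik | hik | hik
  · rw [if_neg hik.ne, if_neg]
    have : augKnot ξ (i + 1) ≤ augKnot ξ (k + 3) := hm (by omega)
    rintro (⟨-, h⟩ | ⟨-, h, h'⟩) <;> linarith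
  · subst hik
    rw [if_pos rfl, if_pos]
    rw [show (k : ℕ) + 3 + 1 = k + 4 by ring, e1, e2]
    rcases h2 with h2 | ⟨rfl, h2⟩
    · exact Or.inl ⟨h1, h2⟩
    · exact Or.inr ⟨h2 ▸ hlt, h2, h2.trans (by rw [Fin.succ_last])⟩
  · rw [if_neg hik.ne', if_neg]
    have a1 : augKnot ξ (k + 4) ≤ augKnot ξ i := hm (by omega)
    have a2 : augKnot ξ i ≤ augKnot ξ (i + 1) := hm (by omega)
    rintro (⟨h3, h4⟩ | ⟨h3, h4, -⟩)
    · rcases h2 with h2 | ⟨rfl, h2⟩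
      · linarith
      · rw [augKnot_of_ge (i + 1) (by simp at hik; omega)] at h4
        rw [Fin.succ_last] at h2
        linarith
    · rcases h2 with h2 | ⟨-, h2⟩ <;> linarith

theorem exists_mem_cell (hξ : StrictMono ξ) {x : ℝ}
    (hx : x ∈ Icc (ξ 0) (ξ (Fin.last (K + 1)))) : ∃ k, x ∈ cell ξ k := by
  rcases hx.2.lt_or_eq with h | h
  · have key : ∀ m : Fin (K + 2), x < ξ m → ∃ k, x ∈ cell ξ k := by
      intro m
      induction m using Fin.induction with
      | zero => intro h; exact absurd hx.1 (not_le.2 h)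
      | succ m ih =>
        intro hlt
        by_cases h' : x < ξ m.castSucc
        · exact ih h'
        · exact ⟨m, not_lt.1 h', Or.inl hlt⟩
    exact key _ h
  · refine ⟨Fin.last K, ?_, Or.inr ⟨rfl, by rw [h, Fin.succ_last]⟩⟩
    rw [h]
    exact hξ.monotone (Fin.le_last _)

theorem sum_bspline_zero (hξ : StrictMono ξ) {x : ℝ}
    (hx : x ∈ Icc (ξ 0) (ξ (Fin.last (K + 1)))) :
    ∑ i ∈ Finset.range (K + 4), bspline ξ 0 i x = 1 := by
  obtain ⟨k, hk⟩ := exists_mem_cell hξ hx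
  simp only [bspline_zero_of_mem_cell hξ hk]
  have := k.is_lt
  simp [Finset.sum_ite_eq']
  omega

/-- Partition of unity. -/
theorem sum_bspline_eq_one (hξ : StrictMono ξ) {x : ℝ}
    (hx : x ∈ Icc (ξ 0) (ξ (Fin.last (K + 1)))) (d : ℕ) (hd : d ≤ 3) :
    ∑ i ∈ Finset.range (K + 4), bspline ξ d i x = 1 := by
  induction d with
  | zero => exact sum_bspline_zero hξ hx
  | succ d ih =>
    have h := sum_bspline_succ hξ.monotone d (by omega) (fun _ => 1) x
    simp only [one_mul] at h
    rw [h, ← ih (by omega)]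
    refine Finset.sum_congr rfl fun i _ => ?_
    by_cases e : augKnot ξ (i + d + 1) = augKnot ξ i
    · simp [bspline_eq_zero_of_knots_eq d i x hξ.monotone e]
    · have : augKnot ξ (i + d + 1) - augKnot ξ i ≠ 0 := sub_ne_zero.2 e
      rw [show x - augKnot ξ i + (augKnot ξ (i + d + 1) - x) =
        augKnot ξ (i + d + 1) - augKnot ξ i by ring, div_self this, one_mul]

/-- Reproduction of the identity function, with coefficients the knot averages. -/
theorem sum_knots_mul_bspline (hξ : StrictMono ξ) {x : ℝ}
    (hx : x ∈ Icc (ξ 0) (ξ (Fin.last (K + 1)))) (d : ℕ) (hd : d ≤ 3) :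
    ∑ i ∈ Finset.range (K + 4),
      (∑ l ∈ Finset.range d, augKnot ξ (i + l + 1)) * bspline ξ d i x = d * x := by
  induction d with
  | zero => simp
  | succ d ih =>
    have h := sum_bspline_succ hξ.monotone d (by omega)
      (fun i => ∑ l ∈ Finset.range (d + 1), augKnot ξ (i + l)) x
    have e : ∀ i, ∑ l ∈ Finset.range (d + 1), augKnot ξ (i + l + 1) =
        ∑ l ∈ Finset.range (d + 1), augKnot ξ (i + 1 + l) := fun i =>
      Finset.sum_congr rfl fun l _ => by rw [show i + l + 1 = i + 1 + l by ring]
    simp only [e]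
    rw [h]
    have e3 : ((d + 1 : ℕ) : ℝ) * x =
        ∑ i ∈ Finset.range (K + 4), (∑ l ∈ Finset.range d, augKnot ξ (i + l + 1) + x) *
          bspline ξ d i x := by
      simp only [add_mul]
      rw [Finset.sum_add_distrib, ih (by omega), ← Finset.mul_sum,
        sum_bspline_eq_one hξ hx d (by omega)]
      push_cast; ring
    rw [e3]
    refine Finset.sum_congr rfl fun i _ => ?_
    by_cases e4 : augKnot ξ (i + d + 1) = augKnot ξ i
    · simp [bspline_eq_zero_of_knots_eq d i x hξ.monotone e4]
    · congr 1
      have : augKnot ξ (i + d + 1) - augKnot ξ i ≠ 0 := sub_ne_zero.2 e4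
      -- With `S` the sum of the knots strictly between the ends `τ` and `τ'`, the identity is `(S +
      -- τ')(x - τ) + (S + τ)(τ' - x) = (τ' - τ)(S + x)`.
      rw [div_eq_iff this, ← e, Finset.sum_range_succ, Finset.sum_range_succ']
      simp only [← add_assoc, add_zero]
      ring

/-! ### Differentiation of B-splines through their polynomial pieces. -/

/-- The polynomial with which `bspline ξ d i` agrees on the knot interval `[τ_m, τ_{m+1})`. -/
noncomputable def cellPoly (ξ : Fin (K + 2) → ℝ) (m : ℕ) : ℕ → ℕ → ℝ → ℝ
  | 0, i, _ => if i = m then 1 else 0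
  | d + 1, i, x =>
      (x - augKnot ξ i) / (augKnot ξ (i + d + 1) - augKnot ξ i) * cellPoly ξ m d i x +
        (augKnot ξ (i + d + 2) - x) / (augKnot ξ (i + d + 2) - augKnot ξ (i + 1)) *
          cellPoly ξ m d (i + 1) x

theorem bspline_eq_cellPoly_of_mem_cell (hξ : StrictMono ξ) {k : Fin (K + 1)} {x : ℝ}
    (hx : x ∈ cell ξ k) (d i : ℕ) : bspline ξ d i x = cellPoly ξ (k + 3) d i x := by
  induction d generalizing i with
  | zero => exact bspline_zero_of_mem_cell hξ hx i
  | succ d ih => simp only [bspline, cellPoly, ih]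

/-- Continuity at simple knots. The degree-zero pieces disagree, so the first case to check is
degree one; afterwards the recursion has the same coefficients on both sides of the knot. -/
theorem cellPoly_eq_at_knot {m : ℕ} (h1 : augKnot ξ m < augKnot ξ (m + 1))
    (h2 : augKnot ξ (m + 1) < augKnot ξ (m + 2)) (d i : ℕ) :
    cellPoly ξ m (d + 1) i (augKnot ξ (m + 1)) =
      cellPoly ξ (m + 1) (d + 1) i (augKnot ξ (m + 1)) := by
  induction d generalizing i with
  | zero =>
    simp only [cellPoly, add_zero]
    by_cases a : i = m
    · subst a
      simp [div_self (sub_pos.2 h1).ne', div_self (sub_pos.2 h2).ne']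
    · by_cases b : i = m + 1
      · subst b
        simp
        omega
      · by_cases c : i + 1 = m
        · subst c
          simp
          omega
        · simp [a, b, c]
  | succ d ih =>
    rw [cellPoly.eq_2 ξ m, cellPoly.eq_2 ξ (m + 1), ih, ih]

theorem bspline_eq_cellPoly (hξ : StrictMono ξ) (k : Fin (K + 1)) {x : ℝ}
    (hx : x ∈ Icc (ξ k.castSucc) (ξ k.succ)) (d i : ℕ) :
    bspline ξ (d + 1) i x = cellPoly ξ (k + 3) (d + 1) i x := by
  rcases hx.2.lt_or_eq with h | h
  · exact bspline_eq_cellPoly_of_mem_cell hξ ⟨hx.1, Or.inl h⟩ _ _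
  by_cases hk : k = Fin.last K
  · exact bspline_eq_cellPoly_of_mem_cell hξ ⟨hx.1, Or.inr ⟨hk, h⟩⟩ _ _
  · have hk' : (k : ℕ) < K := Fin.val_lt_last hk
    let k' : Fin (K + 1) := ⟨k + 1, by omega⟩
    have e : k'.castSucc = k.succ := by ext; simp [k']
    have hc : x ∈ cell ξ k' := by
      refine ⟨by rw [e, h], Or.inl ?_⟩
      rw [h, ← e]
      exact hξ Fin.castSucc_lt_succ
    rw [bspline_eq_cellPoly_of_mem_cell hξ hc, h, ← augKnot_succ (ξ := ξ) k]
    refine (cellPoly_eq_at_knot (m := k + 3) ?_ ?_ d i).symm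
    · rw [augKnot_castSucc, show (k : ℕ) + 3 + 1 = k + 4 by ring, augKnot_succ]
      exact hξ Fin.castSucc_lt_succ
    · rw [show (k : ℕ) + 3 + 1 = k' + 3 by simp [k'],
        show (k : ℕ) + 3 + 2 = k' + 4 by simp [k'], augKnot_castSucc, augKnot_succ]
      exact hξ Fin.castSucc_lt_succ

/-- The coefficient identity behind the derivative formula for B-splines. -/
theorem cellPoly_diff_identity (hξ : Monotone ξ) (m d i : ℕ) (x : ℝ) :
    (x - augKnot ξ i) / (augKnot ξ (i + d + 2) - augKnot ξ i) *
        (cellPoly ξ m d i x / (augKnot ξ (i + d + 1) - augKnot ξ i) -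
          cellPoly ξ m d (i + 1) x / (augKnot ξ (i + d + 2) - augKnot ξ (i + 1))) +
      (augKnot ξ (i + d + 3) - x) / (augKnot ξ (i + d + 3) - augKnot ξ (i + 1)) *
        (cellPoly ξ m d (i + 1) x / (augKnot ξ (i + d + 2) - augKnot ξ (i + 1)) -
          cellPoly ξ m d (i + 2) x / (augKnot ξ (i + d + 3) - augKnot ξ (i + 2))) =
    cellPoly ξ m (d + 1) i x / (augKnot ξ (i + d + 2) - augKnot ξ i) -
      cellPoly ξ m (d + 1) (i + 1) x / (augKnot ξ (i + d + 3) - augKnot ξ (i + 1)) := by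
  have hm := augKnot_mono hξ
  simp only [cellPoly]
  rw [show i + 1 + d + 1 = i + d + 2 by ring, show i + 1 + d + 2 = i + d + 3 by ring,
    show i + 1 + 1 = i + 2 by ring]
  generalize cellPoly ξ m d i x = p0
  generalize cellPoly ξ m d (i + 1) x = p1
  generalize cellPoly ξ m d (i + 2) x = p2
  have m1 : augKnot ξ i ≤ augKnot ξ (i + 1) := hm (by omega)
  have m2 : augKnot ξ (i + 1) ≤ augKnot ξ (i + d + 2) := hm (by omega)
  have m3 : augKnot ξ (i + d + 2) ≤ augKnot ξ (i + d + 3) := hm (by omega)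
  generalize augKnot ξ i = t0 at *
  generalize augKnot ξ (i + 1) = t1 at *
  generalize augKnot ξ (i + 2) = t2 at *
  generalize augKnot ξ (i + d + 1) = s1 at *
  generalize augKnot ξ (i + d + 2) = s2 at *
  generalize augKnot ξ (i + d + 3) = s3 at *
  rcases m2.eq_or_lt with h | h
  -- The middle B-spline has degenerate support; its quotients by zero are read as `0`, and the
  -- other terms match.
  · simp only [h, sub_self, div_zero, zero_mul]
    ring
  · have a : s2 - t1 ≠ 0 := by linarith
    have b : s2 - t0 ≠ 0 := by linarith
    have c : s3 - t1 ≠ 0 := by linarith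
    have : (s2 - x) / (s2 - t1) * p1 / (s2 - t0) - (x - t1) / (s2 - t1) * p1 / (s3 - t1) =
        - ((x - t0) / (s2 - t0) * (p1 / (s2 - t1))) +
          (s3 - x) / (s3 - t1) * (p1 / (s2 - t1)) := by
      field_simp
      ring
    linear_combination -this

/-- Differentiate the recursion by the product rule. By induction the differentiated factors are
differences of lower-degree pieces, and `cellPoly_diff_identity` recombines them into `d + 1`
further copies of the same difference. -/
theorem hasDerivAt_cellPoly (hξ : Monotone ξ) (m d i : ℕ) (x : ℝ) :
    HasDerivAt (cellPoly ξ m (d + 1) i)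
      ((d + 1) * (cellPoly ξ m d i x / (augKnot ξ (i + d + 1) - augKnot ξ i) -
        cellPoly ξ m d (i + 1) x / (augKnot ξ (i + d + 2) - augKnot ξ (i + 1)))) x := by
  have step : ∀ (d i : ℕ) (p q : ℝ), HasDerivAt (cellPoly ξ m d i) p x →
      HasDerivAt (cellPoly ξ m d (i + 1)) q x →
      HasDerivAt (cellPoly ξ m (d + 1) i)
        ((1 / (augKnot ξ (i + d + 1) - augKnot ξ i)) * cellPoly ξ m d i x +
          (x - augKnot ξ i) / (augKnot ξ (i + d + 1) - augKnot ξ i) * p +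
         ((-1 / (augKnot ξ (i + d + 2) - augKnot ξ (i + 1))) * cellPoly ξ m d (i + 1) x +
          (augKnot ξ (i + d + 2) - x) / (augKnot ξ (i + d + 2) - augKnot ξ (i + 1)) * q)) x := by
    intro d i p q hp hq
    exact ((((hasDerivAt_id x).sub_const _).div_const _).mul hp).add
      ((((hasDerivAt_id x).const_sub _).div_const _).mul hq)
  induction d generalizing i with
  | zero =>
    have h0 : ∀ j, HasDerivAt (cellPoly ξ m 0 j) 0 x := fun j => hasDerivAt_const x _
    convert step 0 i 0 0 (h0 _) (h0 _) using 1
    simp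
    ring
  | succ d ih =>
    convert step (d + 1) i _ _ (ih i) (ih (i + 1)) using 1
    have key := cellPoly_diff_identity hξ m d i x
    rw [show i + 1 + d + 1 = i + d + 2 by ring, show i + 1 + d + 2 = i + d + 3 by ring,
      show i + 1 + 1 = i + 2 by ring, show i + (d + 1) + 1 = i + d + 2 by ring,
      show i + (d + 1) + 2 = i + d + 3 by ring]
    push_cast
    linear_combination (-(d + 1 : ℝ)) * key

/-- The derivative formula for B-splines, valid up to the boundary and across the knots. -/
theorem hasDerivWithinAt_bspline (hξ : StrictMono ξ) (d i : ℕ) (x : ℝ) :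
    HasDerivWithinAt (bspline ξ (d + 2) i)
      ((d + 2) * (bspline ξ (d + 1) i x / (augKnot ξ (i + d + 2) - augKnot ξ i) -
        bspline ξ (d + 1) (i + 1) x / (augKnot ξ (i + d + 3) - augKnot ξ (i + 1))))
      (Icc (ξ 0) (ξ (Fin.last (K + 1)))) x := by
  have hsub : Icc (ξ 0) (ξ (Fin.last (K + 1))) ⊆
      ⋃ k ∈ (Finset.univ : Finset (Fin (K + 1))), Icc (ξ k.castSucc) (ξ k.succ) := by
    intro t ht
    obtain ⟨k, h1, h2⟩ := exists_mem_cell hξ ht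
    simp only [Finset.mem_univ, iUnion_true, mem_iUnion]
    exact ⟨k, h1, by rcases h2 with h2 | ⟨-, h2⟩ <;> exact h2.le⟩
  refine HasDerivWithinAt.mono ?_ hsub
  induction (Finset.univ : Finset (Fin (K + 1))) using Finset.induction_on with
  | empty => exact HasFDerivWithinAt.of_notMem_closure (by simp)
  | insert k s _ ih =>
    rw [Finset.set_biUnion_insert]
    refine HasDerivWithinAt.union ?_ ih
    by_cases hx : x ∈ Icc (ξ k.castSucc) (ξ k.succ)
    · have h := (hasDerivAt_cellPoly hξ.monotone (k + 3) (d + 1) i x).hasDerivWithinAt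
        (s := Icc (ξ k.castSucc) (ξ k.succ))
      rw [← bspline_eq_cellPoly hξ k hx, ← bspline_eq_cellPoly hξ k hx] at h
      refine (h.congr (fun t ht => bspline_eq_cellPoly hξ k ht _ _)
        (bspline_eq_cellPoly hξ k hx _ _)).congr_deriv ?_
      push_cast
      rw [show i + (d + 1) + 1 = i + d + 2 by ring, show i + (d + 1) + 2 = i + d + 3 by ring]
      ring
    -- Away from a closed cell any value is a derivative within that cell, so only the cells
    -- containing `x` impose a condition.
    · exact HasFDerivWithinAt.of_notMem_closure (by rwa [isClosed_Icc.closure_eq])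

end Bspline

end MonoSpline

/-- The mean value inequality is applied twice, the second time on the part of `S` within distance
`|s - t|` of `t`. The lost factor `1/2` is harmless for the final constant. -/
theorem Convex.abs_taylor_one_le {f f' f'' : ℝ → ℝ} {S : Set ℝ} {L : ℝ} (hS : Convex ℝ S)
    (hf : ∀ t ∈ S, HasDerivWithinAt f (f' t) S t)
    (hf' : ∀ t ∈ S, HasDerivWithinAt f' (f'' t) S t)
    (hL : ∀ t ∈ S, |f'' t| ≤ L) {s t : ℝ} (hs : s ∈ S) (ht : t ∈ S) :
    |f s - f t - f' t * (s - t)| ≤ L * (s - t) ^ 2 := by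
  have hL0 : 0 ≤ L := (abs_nonneg _).trans (hL t ht)
  have lip : ∀ u ∈ S, |f' u - f' t| ≤ L * |u - t| := fun u hu =>
    hS.norm_image_sub_le_of_norm_hasDerivWithin_le hf' hL ht hu
  have hT : Convex ℝ (S ∩ Metric.closedBall t |s - t|) := hS.inter (convex_closedBall _ _)
  have hφ : ∀ u ∈ S ∩ Metric.closedBall t |s - t|,
      HasDerivWithinAt (fun u => f u - f' t * u) (f' u - f' t)
        (S ∩ Metric.closedBall t |s - t|) u := fun u hu => by
    have := (((hf u hu.1).mono inter_subset_left).sub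
      ((hasDerivWithinAt_id u (S ∩ Metric.closedBall t |s - t|)).const_mul (f' t)))
    rw [mul_one] at this
    exact this
  have := hT.norm_image_sub_le_of_norm_hasDerivWithin_le (C := L * |s - t|) hφ
    (fun u hu => (lip u hu.1).trans (mul_le_mul_of_nonneg_left
      (by simpa [Real.dist_eq] using hu.2) hL0))
    (x := t) (y := s) ⟨ht, by simp⟩ ⟨hs, by simp [Real.dist_eq]⟩
  rw [Real.norm_eq_abs, Real.norm_eq_abs, mul_assoc, abs_mul_abs_self, ← sq] at this
  convert this using 2
  ring

namespace MonoSpline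

/-! ### Schoenberg's operator and the approximation error. -/

section Schoenberg

variable {K n : ℕ} {ξ : Fin (K + 2) → ℝ} {γ : Fin (K + 4) → ℝ} {x : Fin n → ℝ} {L η₁ η₂ : ℝ}

theorem exists_hasDerivWithinAt_spline (hξ : StrictMono ξ) (γ : Fin (K + 4) → ℝ) :
    ∃ g g₂ : ℝ → ℝ, ∀ t,
      HasDerivWithinAt (spline ξ γ) (g t) (Icc (ξ 0) (ξ (Fin.last (K + 1)))) t ∧
      HasDerivWithinAt g (g₂ t) (Icc (ξ 0) (ξ (Fin.last (K + 1)))) t := by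
  refine ⟨_, _, fun t => ⟨HasDerivWithinAt.fun_sum fun j _ =>
    (hasDerivWithinAt_bspline hξ 1 j t).const_mul (γ j),
    HasDerivWithinAt.fun_sum fun j _ => HasDerivWithinAt.const_mul (γ j)
      (HasDerivWithinAt.const_mul _ (HasDerivWithinAt.sub
        (HasDerivWithinAt.div_const (hasDerivWithinAt_bspline hξ 0 j t) _)
        (HasDerivWithinAt.div_const (hasDerivWithinAt_bspline hξ 0 (j + 1) t) _)))⟩⟩

theorem Setup.abs_taylor_one_le (h : Setup L η₁ η₂ ξ x γ) : ∃ g : ℝ → ℝ,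
    ∀ s ∈ Icc (0 : ℝ) 1, ∀ t ∈ Icc (0 : ℝ) 1,
      |spline ξ γ s - spline ξ γ t - g t * (s - t)| ≤ L * (s - t) ^ 2 := by
  obtain ⟨g, g₂, hg⟩ := exists_hasDerivWithinAt_spline h.knots_strictMono γ
  rw [h.knots_zero, h.knots_last] at hg
  refine ⟨g, fun s hs t ht => (convex_Icc 0 1).abs_taylor_one_le (fun t _ => (hg t).1)
    (fun t _ => (hg t).2) (fun t ht => ?_) hs ht⟩
  have hu : UniqueDiffOn ℝ (Icc (0 : ℝ) 1) := uniqueDiffOn_Icc zero_lt_one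
  have := h.second_deriv t ht
  rw [iteratedDerivWithin_succ] at this
  have e : derivWithin (iteratedDerivWithin 1 (spline ξ γ) (Icc 0 1)) (Icc 0 1) t = g₂ t := by
    rw [← (hg t).2.derivWithin (hu t ht)]
    refine derivWithin_congr (fun u hu' => ?_) ?_
    · rw [iteratedDerivWithin_one, (hg u).1.derivWithin (hu u hu')]
    · rw [iteratedDerivWithin_one, (hg t).1.derivWithin (hu t ht)]
  rwa [e] at this

/-- The Greville abscissae (knot averages) of the cubic B-splines. -/
noncomputable def greville (ξ : Fin (K + 2) → ℝ) (j : ℕ) : ℝ :=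
  (augKnot ξ (j + 1) + augKnot ξ (j + 2) + augKnot ξ (j + 3)) / 3

/-- The coefficients of Schoenberg's variation diminishing approximation. -/
noncomputable def schoenberg (ξ : Fin (K + 2) → ℝ) (γ : Fin (K + 4) → ℝ) (j : Fin (K + 4)) : ℝ :=
  spline ξ γ (greville ξ j)

theorem Setup.augKnot_mem (h : Setup L η₁ η₂ ξ x γ) (i : ℕ) : augKnot ξ i ∈ Icc (0 : ℝ) 1 := by
  rw [← h.knots_zero, ← h.knots_last]
  exact ⟨h.knots_strictMono.monotone (Fin.zero_le _), h.knots_strictMono.monotone (Fin.le_last _)⟩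

theorem Setup.greville_mem (h : Setup L η₁ η₂ ξ x γ) (i : ℕ) : greville ξ i ∈ Icc (0 : ℝ) 1 := by
  obtain ⟨a, b⟩ := h.augKnot_mem (i + 1)
  obtain ⟨c, d⟩ := h.augKnot_mem (i + 2)
  obtain ⟨e, f⟩ := h.augKnot_mem (i + 3)
  unfold greville
  constructor <;> linarith

/-- This makes the approximation an admissible competitor in the constrained problem, which `γ` need
not be. -/
theorem Setup.schoenberg_monotone (h : Setup L η₁ η₂ ξ x γ) : Monotone (schoenberg ξ γ) := by
  intro i j hij
  have hm := augKnot_mono h.knots_strictMono.monotone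
  have hij' : (i : ℕ) ≤ j := hij
  refine h.monotone (h.greville_mem i) (h.greville_mem j) ?_
  have a : augKnot ξ (i + 1) ≤ augKnot ξ (j + 1) := hm (by omega)
  have b : augKnot ξ (i + 2) ≤ augKnot ξ (j + 2) := hm (by omega)
  have c : augKnot ξ (i + 3) ≤ augKnot ξ (j + 3) := hm (by omega)
  unfold greville
  linarith

theorem Setup.spacing_pos (h : Setup L η₁ η₂ ξ x γ) : 0 < (1 + η₂) / ((K : ℝ) + 1) :=
  (sub_pos.2 (h.knots_strictMono Fin.castSucc_lt_succ)).trans_le (h.knots_spacing 0)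

theorem Setup.augKnot_sub_le (h : Setup L η₁ η₂ ξ x γ) (i : ℕ) :
    augKnot ξ (i + 1) - augKnot ξ i ≤ (1 + η₂) / ((K : ℝ) + 1) := by
  by_cases h1 : i < 3
  · rw [augKnot_of_le _ (by omega), augKnot_of_le _ (by omega), sub_self]
    exact h.spacing_pos.le
  by_cases h2 : K + 4 ≤ i
  · rw [augKnot_of_ge _ (by omega), augKnot_of_ge _ (by omega), sub_self]
    exact h.spacing_pos.le
  let k : Fin (K + 1) := ⟨i - 3, by omega⟩
  have := h.knots_spacing k
  rw [← augKnot_succ (ξ := ξ) k, ← augKnot_castSucc (ξ := ξ) k] at this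
  simpa [k, show i - 3 + 4 = i + 1 by omega, show i - 3 + 3 = i by omega] using this

theorem sum_fin_bspline_eq_one (hξ : StrictMono ξ) {t : ℝ}
    (ht : t ∈ Icc (ξ 0) (ξ (Fin.last (K + 1)))) :
    ∑ j : Fin (K + 4), bspline ξ 3 (j : ℕ) t = 1 := by
  rw [Fin.sum_univ_eq_sum_range (fun j => bspline ξ 3 j t)]
  exact sum_bspline_eq_one hξ ht 3 le_rfl

theorem sum_greville_mul_bspline (hξ : StrictMono ξ) {t : ℝ}
    (ht : t ∈ Icc (ξ 0) (ξ (Fin.last (K + 1)))) :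
    ∑ j : Fin (K + 4), greville ξ j * bspline ξ 3 (j : ℕ) t = t := by
  rw [Fin.sum_univ_eq_sum_range (fun j => greville ξ j * bspline ξ 3 j t)]
  have h := sum_knots_mul_bspline hξ ht 3 le_rfl
  push_cast at h
  rw [← mul_right_inj' (three_ne_zero' ℝ), ← h, Finset.mul_sum]
  refine Finset.sum_congr rfl fun i _ => ?_
  simp only [greville, Finset.sum_range_succ, Finset.sum_range_zero]
  ring_nf

/-- On the support `[τ_j, τ_{j+4}]` the distance to the knot average is at most `(h + 2h + 3h)/3 =
2h`, and it is at most `1` since both points lie in `[0, 1]`. Multiplying the two bounds gives an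
estimate linear in `h`. -/
theorem Setup.sq_greville_sub_le (h : Setup L η₁ η₂ ξ x γ) {t : ℝ} (ht : t ∈ Icc (0 : ℝ) 1)
    {j : ℕ} (hj : bspline ξ 3 j t ≠ 0) :
    (greville ξ j - t) ^ 2 ≤ 2 * ((1 + η₂) / ((K : ℝ) + 1)) := by
  obtain ⟨h1, h2⟩ := (bspline_nonneg_and_support h.knots_strictMono.monotone 3 j t).2 hj
  have a0 := h.augKnot_sub_le j
  have a1 := h.augKnot_sub_le (j + 1)
  have a2 := h.augKnot_sub_le (j + 2)
  have a3 := h.augKnot_sub_le (j + 3)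
  obtain ⟨g0, g1⟩ := h.greville_mem j
  have b1 : |greville ξ j - t| ≤ 1 := abs_le.2 ⟨by linarith [ht.2], by linarith [ht.1]⟩
  have b2 : |greville ξ j - t| ≤ 2 * ((1 + η₂) / ((K : ℝ) + 1)) := by
    simp only [add_assoc, Nat.reduceAdd] at *
    unfold greville
    rw [abs_le]
    constructor <;> linarith
  rw [← sq_abs]
  nlinarith [abs_nonneg (greville ξ j - t)]

/-- Uniform error of Schoenberg's approximation of a spline with bounded second derivative. -/
theorem Setup.abs_spline_sub_schoenberg_le (h : Setup L η₁ η₂ ξ x γ) {t : ℝ}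
    (ht : t ∈ Icc (0 : ℝ) 1) :
    |spline ξ γ t - spline ξ (schoenberg ξ γ) t| ≤ 2 * L * ((1 + η₂) / ((K : ℝ) + 1)) := by
  obtain ⟨g, hg⟩ := h.abs_taylor_one_le
  have hL : 0 ≤ L := (abs_nonneg _).trans (h.second_deriv t ht)
  have hξ := h.knots_strictMono
  have ht' := ht
  rw [← h.knots_zero, ← h.knots_last] at ht'
  have s1 := sum_fin_bspline_eq_one hξ ht'
  have s2 := sum_greville_mul_bspline hξ ht'
  -- Subtracting the linear Taylor term is free: its weighted mean is zero by `s1` and `s2`.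
  have key : spline ξ (schoenberg ξ γ) t - spline ξ γ t =
      ∑ j : Fin (K + 4), (spline ξ γ (greville ξ j) - spline ξ γ t - g t * (greville ξ j - t)) *
        bspline ξ 3 j t := by
    have : ∑ j : Fin (K + 4),
        (spline ξ γ (greville ξ j) - spline ξ γ t - g t * (greville ξ j - t)) * bspline ξ 3 j t =
        spline ξ (schoenberg ξ γ) t - spline ξ γ t * ∑ j : Fin (K + 4), bspline ξ 3 (j : ℕ) t -
        g t * (∑ j : Fin (K + 4), greville ξ j * bspline ξ 3 (j : ℕ) t -
          t * ∑ j : Fin (K + 4), bspline ξ 3 (j : ℕ) t) := by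
      rw [show spline ξ (schoenberg ξ γ) t =
        ∑ j : Fin (K + 4), schoenberg ξ γ j * bspline ξ 3 (j : ℕ) t from rfl]
      generalize spline ξ γ t = a
      simp only [Finset.mul_sum, ← Finset.sum_sub_distrib]
      refine Finset.sum_congr rfl fun j _ => ?_
      simp only [schoenberg]
      ring
    rw [this, s1, s2]
    ring
  rw [abs_sub_comm, key]
  calc _ ≤ ∑ j : Fin (K + 4), 2 * L * ((1 + η₂) / ((K : ℝ) + 1)) * bspline ξ 3 (j : ℕ) t := by
        refine (Finset.abs_sum_le_sum_abs _ _).trans (Finset.sum_le_sum fun j _ => ?_)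
        rw [abs_mul, abs_of_nonneg (bspline_nonneg hξ.monotone 3 j t)]
        by_cases hj : bspline ξ 3 j t = 0
        · simp [hj]
        · refine mul_le_mul_of_nonneg_right ((hg _ (h.greville_mem j) _ ht).trans ?_)
            (bspline_nonneg hξ.monotone 3 j t)
          nlinarith [mul_le_mul_of_nonneg_left (h.sq_greville_sub_le ht hj) hL]
    _ = _ := by rw [← Finset.mul_sum, s1, mul_one]

/-- The cells cover all design points, so summing the cell counts gives `n ≤ n (1 + η₁)`. -/
theorem Setup.eta_nonneg (h : Setup L η₁ η₂ ξ x γ) (hn : 1 ≤ n) : 0 ≤ η₁ := by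
  classical
  have hn' : (1 : ℝ) ≤ n := by exact_mod_cast hn
  have cov : (Finset.univ : Finset (Fin n)) ⊆
      Finset.univ.biUnion fun k : Fin (K + 1) => Finset.univ.filter fun i => x i ∈ cell ξ k := by
    intro i _
    obtain ⟨k, hk⟩ := exists_mem_cell h.knots_strictMono (x := x i)
      (by rw [h.knots_zero, h.knots_last]; exact h.design_mem i)
    simp only [Finset.mem_biUnion, Finset.mem_filter, Finset.mem_univ, true_and]
    exact ⟨k, hk⟩
  have c1 : n ≤ ∑ k : Fin (K + 1), (Finset.univ.filter fun i => x i ∈ cell ξ k).card := by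
    simpa using (Finset.card_le_card cov).trans Finset.card_biUnion_le
  have c2 : (n : ℝ) ≤ ∑ k : Fin (K + 1), (n : ℝ) / ((K : ℝ) + 1) * (1 + η₁) := by
    calc (n : ℝ) ≤ ∑ k : Fin (K + 1), ((Finset.univ.filter fun i => x i ∈ cell ξ k).card : ℝ) := by
          exact_mod_cast c1
      _ ≤ _ := Finset.sum_le_sum fun k _ => by
          simpa [Nat.card_eq_fintype_card, Fintype.card_subtype] using h.design_count k
  have hK : (0 : ℝ) < (K : ℝ) + 1 := by positivity
  rw [Finset.sum_const, Finset.card_univ, Fintype.card_fin, nsmul_eq_mul] at c2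
  push_cast at c2
  rw [← mul_assoc, mul_div_cancel₀ _ hK.ne'] at c2
  nlinarith

theorem Setup.mse_schoenberg_le (h : Setup L η₁ η₂ ξ x γ) (hn : 1 ≤ n) :
    mse ξ x γ (schoenberg ξ γ) ≤ approxBound L η₁ η₂ (K + 4) := by
  have hn' : (0 : ℝ) < n := by exact_mod_cast hn
  have hK : (0 : ℝ) < (K : ℝ) + 1 := by positivity
  set b := 2 * L * ((1 + η₂) / ((K : ℝ) + 1)) with hb
  have h1 : mse ξ x γ (schoenberg ξ γ) ≤ b ^ 2 := by
    unfold mse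
    rw [one_div, inv_mul_le_iff₀ hn']
    calc _ ≤ ∑ i : Fin n, b ^ 2 := Finset.sum_le_sum fun i _ => by
          rw [← sq_abs]
          exact pow_le_pow_left₀ (abs_nonneg _)
            (h.abs_spline_sub_schoenberg_le (h.design_mem i)) 2
      _ = _ := by simp
  refine h1.trans ?_
  -- The target exceeds `b ^ 2` by the factors `9`, `1 + η₁` and `J / (J - 3)`, each at least `1`.
  have e : approxBound L η₁ η₂ (K + 4) =
      (1 + η₁) * (((K : ℝ) + 4) / ((K : ℝ) + 1)) * (9 * b ^ 2) := by
    unfold approxBound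
    push_cast
    rw [show (K : ℝ) + 4 - 3 = K + 1 by ring, hb]
    field_simp
    ring
  have e1 : 1 ≤ ((K : ℝ) + 4) / ((K : ℝ) + 1) := by rw [one_le_div hK]; linarith
  rw [e]
  nlinarith [one_le_mul_of_one_le_of_one_le
    (by linarith [h.eta_nonneg hn] : 1 ≤ 1 + η₁) e1, sq_nonneg b]

/-- Without noise the residual sum of squares is `n` times the error itself, so minimality against
the Schoenberg coefficients suffices. -/
theorem approximation_mse_le (hn : 1 ≤ n) (h : Setup L η₁ η₂ ξ x γ) {γhat : Fin (K + 4) → ℝ}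
    (hfit : IsMonotoneFit ξ x (fun i => spline ξ γ (x i)) γhat) :
    mse ξ x γ γhat ≤ approxBound L η₁ η₂ (K + 4) :=
  (mul_le_mul_of_nonneg_left (hfit.2 _ h.schoenberg_monotone) (by positivity)).trans
    (h.mse_schoenberg_le hn)

end Schoenberg

end MonoSpline

/-! ### Tail bound for quadratic forms in independent sub-Gaussian variables. -/

section QuadraticForm

theorem lintegral_exp_sq_div_four_gaussianReal :
    ∫⁻ g : ℝ, ENNReal.ofReal (Real.exp (g ^ 2 / 4)) ∂(gaussianReal 0 1) =
      ENNReal.ofReal (√2) := by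
  rw [gaussianReal_of_var_ne_zero _ one_ne_zero,
    lintegral_withDensity_eq_lintegral_mul _ (measurable_gaussianPDF 0 1) (by fun_prop)]
  have e : ∀ g : ℝ, (gaussianPDF 0 1 * fun g => ENNReal.ofReal (Real.exp (g ^ 2 / 4))) g =
      ENNReal.ofReal ((√(2 * Real.pi))⁻¹ * Real.exp (-(1 / 4) * g ^ 2)) := by
    intro g
    rw [Pi.mul_apply, gaussianPDF, ← ENNReal.ofReal_mul (gaussianPDFReal_nonneg _ _ _),
      gaussianPDFReal, mul_assoc, ← Real.exp_add]
    congr 3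
    · simp
    · simp
      ring
  simp only [e]
  rw [← ofReal_integral_eq_lintegral_ofReal
    ((integrable_exp_neg_mul_sq (by norm_num)).const_mul _)
    (ae_of_all _ fun g => by positivity), integral_const_mul, integral_gaussian]
  congr 1
  rw [← Real.sqrt_inv, ← Real.sqrt_mul (by positivity)]
  congr 1
  field_simp
  norm_num

theorem lintegral_exp_mul_gaussianReal (t : ℝ) :
    ∫⁻ g : ℝ, ENNReal.ofReal (Real.exp (t * g)) ∂(gaussianReal 0 1) =
      ENNReal.ofReal (Real.exp (t ^ 2 / 2)) := by
  rw [← ofReal_integral_eq_lintegral_ofReal (integrable_exp_mul_gaussianReal t)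
    (ae_of_all _ fun g => by positivity)]
  have := congrFun (mgf_fun_id_gaussianReal (μ := 0) (v := 1)) t
  simp only [mgf] at this
  rw [this]
  simp

theorem lintegral_prod_eval_pi {ι : Type*} [Fintype ι] (μ : Measure ℝ) [IsProbabilityMeasure μ]
    (f : ι → ℝ → ENNReal) (hf : ∀ i, Measurable (f i)) :
    ∫⁻ g : ι → ℝ, ∏ i, f i (g i) ∂(Measure.pi fun _ => μ) = ∏ i, ∫⁻ t, f i t ∂μ := by
  rw [lintegral_prod_eq_prod_lintegral_of_indepFun Finset.univ (fun i (g : ι → ℝ) => f i (g i))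
    (iIndepFun_pi fun i => (hf i).aemeasurable) (fun i => (hf i).comp (measurable_pi_apply i))]
  refine Finset.prod_congr rfl fun i _ => ?_
  exact (measurePreserving_eval (fun _ : ι => μ) i).lintegral_comp (hf i)

variable {Ω : Type*} [MeasurableSpace Ω] {P : Measure Ω}
  {ι κ : Type*} [Fintype ι] [Fintype κ] {σ : ℝ≥0} {ε : ι → Ω → ℝ}

theorem lintegral_exp_sum_mul_le (hind : iIndepFun ε P)
    (hsub : ∀ i, HasSubgaussianMGF (ε i) (σ ^ 2) P) (a : ι → ℝ) :
    ∫⁻ ω, ENNReal.ofReal (Real.exp (∑ i, a i * ε i ω)) ∂P ≤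
      ENNReal.ofReal (Real.exp ((σ : ℝ) ^ 2 * (∑ i, a i ^ 2) / 2)) := by
  have hs := HasSubgaussianMGF.sum_of_iIndepFun (s := Finset.univ)
    (hind.comp (fun i t => a i * t) fun i => by fun_prop)
    (fun i _ => (hsub i).const_mul (a i))
  have hint := hs.integrable_exp_mul 1
  have hle := hs.mgf_le 1
  simp only [mgf, one_mul, Function.comp_apply] at hint hle
  rw [← ofReal_integral_eq_lintegral_ofReal hint (ae_of_all _ fun g => by positivity)]
  refine ENNReal.ofReal_le_ofReal (hle.trans (le_of_eq ?_))
  congr 1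
  push_cast
  rw [Finset.mul_sum, one_pow, mul_one]
  congr 1
  refine Finset.sum_congr rfl fun i _ => ?_
  rw [mul_comm]
  exact NNReal.coe_mul (.mk (a i ^ 2) (sq_nonneg _)) (σ ^ 2)

variable [IsProbabilityMeasure P]

/-- Exponential moment of a quadratic form in independent sub-Gaussian variables, by Gaussian
linearization.  The rows `u k` are assumed to be orthonormal. -/
theorem lintegral_exp_sum_sq_le (hm : ∀ i, Measurable (ε i)) (hind : iIndepFun ε P)
    (hsub : ∀ i, HasSubgaussianMGF (ε i) (σ ^ 2) P) (hσ : 0 < σ) (u : κ → ι → ℝ)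
    (hu : ∀ g : κ → ℝ, ∑ i, (∑ k, g k * u k i) ^ 2 = ∑ k, g k ^ 2) :
    ∫⁻ ω, ENNReal.ofReal (Real.exp ((∑ k, (∑ i, u k i * ε i ω) ^ 2) / (4 * (σ : ℝ) ^ 2))) ∂P ≤
      ENNReal.ofReal (√2 ^ Fintype.card κ) := by
  have hσ' : (0 : ℝ) < σ := hσ
  -- Chosen so that `a ^ 2 / 2 = 1 / (4 σ²)`: the square in the exponent becomes the moment
  -- generating function of a standard Gaussian `g` at `a` times the linear form.
  set a : ℝ := (√2 * σ)⁻¹ with ha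
  have ha2 : a ^ 2 = (2 * (σ : ℝ) ^ 2)⁻¹ := by
    rw [ha, inv_pow, mul_pow, Real.sq_sqrt (by norm_num)]
  have lin : ∀ ω, ENNReal.ofReal
      (Real.exp ((∑ k, (∑ i, u k i * ε i ω) ^ 2) / (4 * (σ : ℝ) ^ 2))) =
      ∫⁻ g : κ → ℝ, ENNReal.ofReal (Real.exp (∑ i, (a * ∑ k, g k * u k i) * ε i ω))
        ∂(Measure.pi fun _ => gaussianReal 0 1) := by
    intro ω
    have e : ∀ g : κ → ℝ, ENNReal.ofReal (Real.exp (∑ i, (a * ∑ k, g k * u k i) * ε i ω)) =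
        ∏ k, ENNReal.ofReal (Real.exp ((a * ∑ i, u k i * ε i ω) * g k)) := by
      intro g
      rw [← ENNReal.ofReal_prod_of_nonneg fun _ _ => by positivity, ← Real.exp_sum]
      congr 2
      simp only [Finset.mul_sum, Finset.sum_mul]
      rw [Finset.sum_comm]
      exact Finset.sum_congr rfl fun k _ => Finset.sum_congr rfl fun i _ => by ring
    simp only [e]
    rw [lintegral_prod_eval_pi (gaussianReal 0 1)
      (fun k t => ENNReal.ofReal (Real.exp ((a * ∑ i, u k i * ε i ω) * t)))
      fun k => by fun_prop]
    simp only [lintegral_exp_mul_gaussianReal]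
    rw [← ENNReal.ofReal_prod_of_nonneg fun _ _ => by positivity, ← Real.exp_sum]
    congr 2
    rw [Finset.sum_div]
    refine Finset.sum_congr rfl fun k _ => ?_
    rw [mul_pow, ha2]
    field_simp
    norm_num
  simp only [lin]
  -- By Tonelli the noise is integrated first, for fixed `g`. Its exponent is linear, and
  -- orthonormality leaves `exp (|g|² / 4)`, whose Gaussian mean is `√2` per coordinate.
  rw [lintegral_lintegral_swap (by
    apply Measurable.aemeasurable
    unfold Function.uncurry
    fun_prop)]
  calc _ ≤ ∫⁻ g : κ → ℝ, ∏ k, ENNReal.ofReal (Real.exp (g k ^ 2 / 4))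
        ∂(Measure.pi fun _ => gaussianReal 0 1) := by
        refine lintegral_mono fun g => (lintegral_exp_sum_mul_le hind hsub _).trans
          (le_of_eq ?_)
        rw [← ENNReal.ofReal_prod_of_nonneg fun _ _ => by positivity, ← Real.exp_sum]
        congr 2
        simp only [mul_pow]
        rw [← Finset.mul_sum, hu, ← Finset.sum_div, ha2]
        field_simp
        ring
    _ = _ := by
        rw [lintegral_prod_eval_pi (gaussianReal 0 1)
          (fun _ t => ENNReal.ofReal (Real.exp (t ^ 2 / 4))) fun k => by fun_prop]
        simp only [lintegral_exp_sq_div_four_gaussianReal]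
        rw [Finset.prod_const, Finset.card_univ, ENNReal.ofReal_pow (by positivity)]

theorem measureReal_sum_sq_ge_le (hm : ∀ i, Measurable (ε i)) (hind : iIndepFun ε P)
    (hsub : ∀ i, HasSubgaussianMGF (ε i) (σ ^ 2) P) (hσ : 0 < σ) (u : κ → ι → ℝ)
    (hu : ∀ g : κ → ℝ, ∑ i, (∑ k, g k * u k i) ^ 2 = ∑ k, g k ^ 2) (s : ℝ) :
    P.real {ω | s ≤ ∑ k, (∑ i, u k i * ε i ω) ^ 2} ≤
      √2 ^ Fintype.card κ * Real.exp (-(s / (4 * (σ : ℝ) ^ 2))) := by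
  have hσ' : (0 : ℝ) < σ := hσ
  have hc : (0 : ℝ) < 4 * (σ : ℝ) ^ 2 := by positivity
  have hE : 0 < Real.exp (s / (4 * (σ : ℝ) ^ 2)) := Real.exp_pos _
  have markov := mul_meas_ge_le_lintegral (μ := P)
    (f := fun ω => ENNReal.ofReal
      (Real.exp ((∑ k, (∑ i, u k i * ε i ω) ^ 2) / (4 * (σ : ℝ) ^ 2))))
    (by fun_prop) (ENNReal.ofReal (Real.exp (s / (4 * (σ : ℝ) ^ 2))))
  have hset : {ω | s ≤ ∑ k, (∑ i, u k i * ε i ω) ^ 2} =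
      {ω | ENNReal.ofReal (Real.exp (s / (4 * (σ : ℝ) ^ 2))) ≤ ENNReal.ofReal
      (Real.exp ((∑ k, (∑ i, u k i * ε i ω) ^ 2) / (4 * (σ : ℝ) ^ 2)))} := by
    ext ω
    simp only [mem_ofPred_eq]
    rw [ENNReal.ofReal_le_ofReal_iff (by positivity), Real.exp_le_exp,
      div_le_div_iff_of_pos_right hc]
  rw [← hset] at markov
  have h := markov.trans (lintegral_exp_sum_sq_le hm hind hsub hσ u hu)
  rw [Real.exp_neg, ← div_eq_mul_inv, le_div_iff₀ hE, mul_comm]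
  have h2 := ENNReal.toReal_mono ENNReal.ofReal_ne_top h
  rwa [ENNReal.toReal_mul, ENNReal.toReal_ofReal hE.le,
    ENNReal.toReal_ofReal (by positivity)] at h2

end QuadraticForm

/-- An orthonormal frame of a subspace of `ℝⁿ`, in coordinates. -/
theorem exists_orthonormal_frame {n : ℕ} (V : Submodule ℝ (Fin n → ℝ)) :
    ∃ u : Fin (Module.finrank ℝ V) → Fin n → ℝ,
      (∀ g : Fin (Module.finrank ℝ V) → ℝ, ∑ i, (∑ k, g k * u k i) ^ 2 = ∑ k, g k ^ 2) ∧
      ∀ e : Fin n → ℝ, ∀ v ∈ V,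
        2 * ∑ i, e i * v i - ∑ i, v i ^ 2 ≤ ∑ k, (∑ i, u k i * e i) ^ 2 := by
  -- `Fin n → ℝ` carries the sup norm, so the subspace is moved to Euclidean space.
  let φ : EuclideanSpace ℝ (Fin n) ≃ₗ[ℝ] (Fin n → ℝ) := WithLp.linearEquiv 2 ℝ (Fin n → ℝ)
  let W : Submodule ℝ (EuclideanSpace ℝ (Fin n)) := V.comap φ.toLinearMap
  have hfr : Module.finrank ℝ W = Module.finrank ℝ V := by
    have : W = V.map φ.symm.toLinearMap := (Submodule.map_equiv_eq_comap_symm φ.symm V).symm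
    rw [this]
    exact LinearEquiv.finrank_map_eq φ.symm V
  let b := (stdOrthonormalBasis ℝ W).reindex (finCongr hfr)
  refine ⟨fun k => φ (b k), fun g => ?_, fun e v hv => ?_⟩
  · have h1 : ‖∑ k, g k • b k‖ ^ 2 = ∑ k, g k ^ 2 := by
      rw [← real_inner_self_eq_norm_sq, b.orthonormal.inner_sum]
      simp [sq]
    rw [← h1, Submodule.coe_norm, EuclideanSpace.norm_sq_eq]
    refine Finset.sum_congr rfl fun i _ => ?_
    rw [Real.norm_eq_abs, sq_abs]
    congr 1
    simp [φ]
  · let e' : EuclideanSpace ℝ (Fin n) := φ.symm e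
    let v' : W := ⟨φ.symm v, by simpa [W] using hv⟩
    have h1 : ∑ k, (∑ i, φ (b k) i * e i) ^ 2 = ‖W.orthogonalProjectionOnto e'‖ ^ 2 := by
      rw [← b.sum_sq_norm_inner_right]
      refine Finset.sum_congr rfl fun k _ => ?_
      rw [Real.norm_eq_abs, sq_abs, Submodule.inner_orthogonalProjectionOnto_eq_of_mem_left]
      congr 1
      simp [PiLp.inner_apply, e', φ, mul_comm]
    have h2 : ∑ i, e i * v i = inner ℝ (W.orthogonalProjectionOnto e') v' := by
      rw [Submodule.inner_orthogonalProjectionOnto_eq_of_mem_right]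
      simp [PiLp.inner_apply, e', v', φ, mul_comm]
    have h3 : ∑ i, v i ^ 2 = ‖v'‖ ^ 2 := by
      rw [Submodule.coe_norm, EuclideanSpace.norm_sq_eq]
      simp [v', φ]
    rw [h1, h2, h3]
    -- Completing the square: `2⟨p, v⟩ - ‖v‖² = ‖p‖² - ‖p - v‖²` for the projection `p` of `e`.
    have := norm_sub_sq_real (W.orthogonalProjectionOnto e') v'
    nlinarith [sq_nonneg ‖W.orthogonalProjectionOnto e' - v'‖]

namespace MonoSpline

/-! ### Deterministic inequalities for the constrained fit. -/

section Fit

variable {K n : ℕ} {ξ : Fin (K + 2) → ℝ} {x : Fin n → ℝ}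

theorem spline_add_smul (ξ : Fin (K + 2) → ℝ) (β δ : Fin (K + 4) → ℝ) (t s : ℝ) :
    spline ξ (fun j => β j + s * (δ j - β j)) t =
      spline ξ β t + s * (spline ξ δ t - spline ξ β t) := by
  simp only [spline]
  rw [← Finset.sum_sub_distrib, Finset.mul_sum, ← Finset.sum_add_distrib]
  exact Finset.sum_congr rfl fun j _ => by ring

/-- Variational inequality for the monotone least-squares fit. -/
theorem IsMonotoneFit.sum_mul_nonpos {y : Fin n → ℝ} {γhat β : Fin (K + 4) → ℝ}
    (h : IsMonotoneFit ξ x y γhat) (hβ : Monotone β) :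
    ∑ i, (y i - spline ξ γhat (x i)) * (spline ξ β (x i) - spline ξ γhat (x i)) ≤ 0 := by
  set A := ∑ i, (y i - spline ξ γhat (x i)) * (spline ξ β (x i) - spline ξ γhat (x i)) with hA
  set D := ∑ i, (spline ξ β (x i) - spline ξ γhat (x i)) ^ 2 with hD
  have hD0 : 0 ≤ D := Finset.sum_nonneg fun i _ => sq_nonneg _
  have key : ∀ s : ℝ, 0 < s → s ≤ 1 → 2 * A ≤ s * D := by
    intro s hs hs1
    have hmono : Monotone fun j => γhat j + s * (β j - γhat j) := by
      intro i j hij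
      have h1 := h.1 hij
      have h2 := hβ hij
      simp only
      nlinarith
    have h3 := h.2 _ hmono
    have h4 : rss ξ x y (fun j => γhat j + s * (β j - γhat j)) =
        rss ξ x y γhat - 2 * s * A + s ^ 2 * D := by
      rw [hA, hD]
      simp only [rss, spline_add_smul, Finset.mul_sum]
      rw [← Finset.sum_sub_distrib, ← Finset.sum_add_distrib]
      exact Finset.sum_congr rfl fun i _ => by ring
    rw [h4] at h3
    have : s * (2 * A) ≤ s * (s * D) := by nlinarith
    exact le_of_mul_le_mul_left this hs
  by_contra! hA0
  -- For this step length `s * D ≤ A`, so `key` would give `2 * A ≤ A`, against `0 < A`.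
  have hs : 0 < min 1 (A / (D + 1)) := lt_min one_pos (by positivity)
  have h1 := key _ hs (min_le_left _ _)
  have h2 : min 1 (A / (D + 1)) * D ≤ A / (D + 1) * D :=
    mul_le_mul_of_nonneg_right (min_le_right _ _) hD0
  have h3 : A / (D + 1) * D ≤ A := by
    rw [div_mul_eq_mul_div, div_le_iff₀ (by linarith)]
    nlinarith
  linarith

/-- Oracle inequality for the monotone least-squares fit. -/
theorem IsMonotoneFit.sum_sq_le {γ γhat β : Fin (K + 4) → ℝ} {e : Fin n → ℝ}
    (h : IsMonotoneFit ξ x (fun i => spline ξ γ (x i) + e i) γhat) (hβ : Monotone β) :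
    ∑ i, (spline ξ γ (x i) - spline ξ γhat (x i)) ^ 2 ≤
      ∑ i, (spline ξ γ (x i) - spline ξ β (x i)) ^ 2 +
      (2 * ∑ i, e i * (spline ξ γhat (x i) - spline ξ β (x i)) -
        ∑ i, (spline ξ γhat (x i) - spline ξ β (x i)) ^ 2) := by
  have h1 := h.sum_mul_nonpos hβ
  -- An exact identity; its last sum is the one the variational inequality makes non-positive.
  have h2 : ∑ i, (spline ξ γ (x i) - spline ξ γhat (x i)) ^ 2 =
      ∑ i, (spline ξ γ (x i) - spline ξ β (x i)) ^ 2 +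
      (2 * ∑ i, e i * (spline ξ γhat (x i) - spline ξ β (x i)) -
        ∑ i, (spline ξ γhat (x i) - spline ξ β (x i)) ^ 2) +
      2 * ∑ i, (spline ξ γ (x i) + e i - spline ξ γhat (x i)) *
        (spline ξ β (x i) - spline ξ γhat (x i)) := by
    simp only [Finset.mul_sum]
    rw [← Finset.sum_sub_distrib, ← Finset.sum_add_distrib, ← Finset.sum_add_distrib]
    exact Finset.sum_congr rfl fun i _ => by ring
  linarith

/-- The space of vectors of values of splines at the design points. -/
noncomputable def fitSpace (ξ : Fin (K + 2) → ℝ) (x : Fin n → ℝ) : Submodule ℝ (Fin n → ℝ) :=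
  LinearMap.range (Matrix.toLin' (designMatrix ξ x))

theorem finrank_fitSpace_le (ξ : Fin (K + 2) → ℝ) (x : Fin n → ℝ) :
    Module.finrank ℝ (fitSpace ξ x) ≤ K + 4 :=
  (LinearMap.finrank_range_le (Matrix.toLin' (designMatrix ξ x))).trans_eq (by simp)

theorem sub_mem_fitSpace (ξ : Fin (K + 2) → ℝ) (x : Fin n → ℝ) (β δ : Fin (K + 4) → ℝ) :
    (fun i => spline ξ β (x i) - spline ξ δ (x i)) ∈ fitSpace ξ x := by
  refine ⟨β - δ, ?_⟩
  ext i
  simp [Matrix.mulVec, dotProduct, designMatrix, spline, ← Finset.sum_sub_distrib, sub_mul,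
    mul_comm (bspline _ _ _ _)]

/-- The `J` eigenvalues sum to the trace, which is at least `c₁`. The trace is the mean over design
points of `∑ B_j²`, at most `∑ B_j = 1` since `0 ≤ B_j ≤ 1`. -/
theorem gramMatrix_eigenvalue_bound_le_one {L η₁ η₂ c₁ : ℝ} {γ : Fin (K + 4) → ℝ} (hn : 1 ≤ n)
    (h : Setup L η₁ η₂ ξ x γ)
    (hev : ∀ ev : ℝ, Module.End.HasEigenvalue (Matrix.toLin' (gramMatrix ξ x)) ev →
      c₁ / ((K + 4 : ℕ) : ℝ) ≤ ev) : c₁ ≤ 1 := by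
  have hn' : (0 : ℝ) < n := by exact_mod_cast hn
  have hH : (gramMatrix ξ x).IsHermitian := by
    ext i j
    simp [gramMatrix, Matrix.mul_apply, mul_comm]
  have h1 : ∀ j, c₁ / ((K + 4 : ℕ) : ℝ) ≤ hH.eigenvalues j := fun j => by
    refine hev _ (Module.End.hasEigenvalue_of_hasEigenvector
      (x := ((hH.eigenvectorBasis j : EuclideanSpace ℝ (Fin (K + 4))) : Fin (K + 4) → ℝ)) ?_)
    rw [Module.End.hasEigenvector_iff, Module.End.mem_eigenspace_iff]
    refine ⟨?_, ?_⟩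
    · rw [Matrix.toLin'_apply, hH.mulVec_eigenvectorBasis j]
    · intro h0
      exact (hH.eigenvectorBasis.orthonormal.ne_zero j) (by ext i; exact congrFun h0 i)
  have h2 : c₁ ≤ (gramMatrix ξ x).trace := by
    rw [hH.trace_eq_sum_eigenvalues]
    calc c₁ = ∑ _j : Fin (K + 4), c₁ / ((K + 4 : ℕ) : ℝ) := by
          rw [Finset.sum_const, Finset.card_univ, Fintype.card_fin, nsmul_eq_mul,
            mul_div_cancel₀ _ (by positivity)]
      _ ≤ _ := Finset.sum_le_sum fun j _ => by simpa using h1 j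
  refine h2.trans ?_
  have h3 : (gramMatrix ξ x).trace =
      (n : ℝ)⁻¹ * ∑ i, ∑ j : Fin (K + 4), bspline ξ 3 (j : ℕ) (x i) ^ 2 := by
    rw [Finset.sum_comm, Finset.mul_sum]
    simp [gramMatrix, Matrix.trace, Matrix.mul_apply, designMatrix, sq]
  rw [h3, inv_mul_le_iff₀ hn', mul_one]
  have hξ := h.knots_strictMono
  calc _ ≤ ∑ i : Fin n, (1 : ℝ) := Finset.sum_le_sum fun i _ => by
        have hx := h.design_mem i
        rw [← h.knots_zero, ← h.knots_last] at hx
        have s1 := sum_fin_bspline_eq_one hξ hx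
        rw [← s1]
        refine Finset.sum_le_sum fun j _ => ?_
        have p := fun j : Fin (K + 4) => bspline_nonneg hξ.monotone 3 j (x i)
        have : bspline ξ 3 j (x i) ≤ 1 := by
          rw [← s1]
          exact Finset.single_le_sum (f := fun j : Fin (K + 4) => bspline ξ 3 (j : ℕ) (x i))
            (fun j _ => p j) (Finset.mem_univ j)
        nlinarith [p j]
    _ = n := by simp

end Fit

end MonoSpline

/-! ### Asymptotics, constants and the probability bound. -/

namespace MonoSpline

theorem approxBound_isBigO (L η₁ η₂ : ℝ) :
    (fun J : ℕ => approxBound L η₁ η₂ J) =O[atTop] fun J : ℕ => 1 / (J : ℝ) ^ 2 := by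
  have h : (fun J : ℕ => (J : ℝ) / ((J : ℝ) - 3) ^ 3) =O[atTop] fun J : ℕ => 1 / (J : ℝ) ^ 2 := by
    refine Asymptotics.IsBigO.of_bound 8 ?_
    filter_upwards [eventually_ge_atTop 6] with J hJ
    have hJ' : (6 : ℝ) ≤ J := by exact_mod_cast hJ
    have h3 : 0 < (J : ℝ) - 3 := by linarith
    rw [Real.norm_of_nonneg (by positivity), Real.norm_of_nonneg (by positivity),
      mul_one_div, div_le_div_iff₀ (by positivity) (by positivity)]
    have := pow_le_pow_left₀ (by positivity) (show (J : ℝ) / 2 ≤ J - 3 by linarith) 3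
    nlinarith
  refine (h.const_mul_left (36 * (1 + η₁) * (1 + η₂) ^ 2 * L ^ 2)).congr_left fun J => ?_
  rw [approxBound, mul_div_assoc]

theorem noiseBound_isBigO (c₁ σ M η₁ : ℝ) :
    (fun J : ℕ => noiseBound c₁ σ M η₁ J)
      =O[atTop] fun J : ℕ => Real.log (J : ℝ) / (J : ℝ) ^ 2 := by
  refine Asymptotics.IsBigO.const_mul_left ?_ _
  refine Asymptotics.IsBigO.of_bound 4 ?_
  filter_upwards [eventually_ge_atTop 6] with J hJ
  have hJ' : (6 : ℝ) ≤ J := by exact_mod_cast hJ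
  have h3 : 0 < (J : ℝ) - 3 := by linarith
  have hl : 0 ≤ Real.log J := Real.log_nonneg (by linarith)
  rw [Real.norm_of_nonneg (by positivity), Real.norm_of_nonneg (by positivity),
    ← mul_div_assoc, div_le_div_iff₀ (by positivity) (by positivity)]
  have := pow_le_pow_left₀ (by positivity) (show (J : ℝ) / 2 ≤ J - 3 by linarith) 2
  nlinarith

theorem one_le_log_of_four_le {t : ℝ} (ht : 4 ≤ t) : 1 ≤ Real.log t := by
  rw [Real.le_log_iff_exp_le (by linarith)]
  linarith [Real.exp_one_lt_d9]

theorem approxBound_add_noiseBound_isBigO (L η₁ η₂ c₁ σ M : ℝ) :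
    (fun J : ℕ => approxBound L η₁ η₂ J + noiseBound c₁ σ M η₁ J)
      =O[atTop] fun J : ℕ => Real.log (J : ℝ) / (J : ℝ) ^ 2 := by
  refine ((approxBound_isBigO L η₁ η₂).trans ?_).add (noiseBound_isBigO c₁ σ M η₁)
  refine Asymptotics.IsBigO.of_bound 1 ?_
  filter_upwards [eventually_ge_atTop 4] with J hJ
  have hl : 1 ≤ Real.log J := one_le_log_of_four_le (by exact_mod_cast hJ)
  rw [Real.norm_of_nonneg (by positivity), Real.norm_of_nonneg (by positivity), one_mul]
  gcongr

/-- The upper bound on `J` gives `J³ ≤ C³ n`, so it is enough that `C³ ≤ 8 log J`. For `C ≤ 1` this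
follows from `J ≥ 4`; otherwise the lower bound on `J` forces `J ≥ exp (C³ / 8)` once `n` is large.
-/
theorem exists_sampleSize (c C : ℝ) (hc : 0 < c) : ∃ N : ℕ, (C ≤ 1 → N ≤ 1) ∧
    ∀ (n : ℕ) (J : ℝ), N ≤ n → 4 ≤ J → c * (n : ℝ) ^ (1 / 3 : ℝ) ≤ J →
      J ≤ C * (n : ℝ) ^ (1 / 3 : ℝ) → J ^ 3 ≤ 8 * Real.log J * n := by
  have cube : ∀ (n : ℕ) (J : ℝ), 4 ≤ J → J ≤ C * (n : ℝ) ^ (1 / 3 : ℝ) → J ^ 3 ≤ C ^ 3 * n := by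
    intro n J hJ h
    have := pow_le_pow_left₀ (by linarith) h 3
    rwa [mul_pow, ← Real.rpow_natCast ((n : ℝ) ^ (1 / 3 : ℝ)), ← Real.rpow_mul (by positivity),
      show (1 / 3 : ℝ) * (3 : ℕ) = 1 by norm_num, Real.rpow_one] at this
  by_cases hC : C ≤ 1
  · refine ⟨1, fun _ => le_rfl, fun n J _ hJ _ h2 => (cube n J hJ h2).trans ?_⟩
    have hl := one_le_log_of_four_le hJ
    have h1 : C ^ 3 ≤ 1 := (Odd.pow_le_pow (by decide : Odd 3)).2 hC |>.trans_eq (one_pow 3)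
    exact mul_le_mul_of_nonneg_right (by linarith) (by positivity)
  · refine ⟨⌈(Real.exp (C ^ 3 / 8) / c) ^ 3⌉₊, fun h => absurd h hC,
      fun n J hn hJ h1 h2 => (cube n J hJ h2).trans ?_⟩
    have hn' : (Real.exp (C ^ 3 / 8) / c) ^ 3 ≤ n := Nat.ceil_le.1 hn
    have h3 : Real.exp (C ^ 3 / 8) / c ≤ (n : ℝ) ^ (1 / 3 : ℝ) := by
      have := Real.rpow_le_rpow (by positivity) hn' (by norm_num : (0 : ℝ) ≤ 1 / 3)
      rwa [← Real.rpow_natCast, ← Real.rpow_mul (by positivity),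
        show ((3 : ℕ) : ℝ) * (1 / 3 : ℝ) = 1 by norm_num, Real.rpow_one] at this
    have h4 : Real.exp (C ^ 3 / 8) ≤ J := by
      rw [div_le_iff₀ hc] at h3
      linarith
    rw [← Real.le_log_iff_exp_le (by linarith)] at h4
    exact mul_le_mul_of_nonneg_right (by linarith) (by positivity)

theorem noise_level_le_noiseBound {K n : ℕ} {η₁ c₁ M σ : ℝ} (hn : 1 ≤ n)
    (hη : 0 ≤ η₁) (hc : 0 < c₁) (hc1 : c₁ ≤ 1) (hM : 0 ≤ M)
    (hJ : ((K + 4 : ℕ) : ℝ) ^ 3 ≤ 8 * Real.log ((K + 4 : ℕ) : ℝ) * n) :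
    1 / (n : ℝ) * (4 * σ ^ 2 * (((K + 4 : ℕ) : ℝ) / 2 + M ^ 2 * Real.log ((K + 4 : ℕ) : ℝ))) ≤
      noiseBound c₁ σ M η₁ (K + 4) := by
  have hn' : (0 : ℝ) < n := by exact_mod_cast hn
  have e : ((K + 4 : ℕ) : ℝ) - 3 = (K : ℝ) + 1 := by push_cast; ring
  have eJ : (K : ℝ) + 1 ≤ ((K + 4 : ℕ) : ℝ) := by push_cast; linarith
  have hK : (0 : ℝ) < (K : ℝ) + 1 := by positivity
  have h4 : (4 : ℝ) ≤ ((K + 4 : ℕ) : ℝ) := by push_cast; linarith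
  unfold noiseBound
  rw [e]
  generalize ((K + 4 : ℕ) : ℝ) = J at *
  have hl : 1 ≤ Real.log J := one_le_log_of_four_le h4
  have hlJ : Real.log J ≤ J := by linarith [Real.log_le_sub_one_of_pos (by linarith : 0 < J)]
  generalize Real.log J = l at *
  have hJ0 : 0 < J := by linarith
  -- From `J³ ≤ 8 n log J` and `log J ≤ J`. The stronger hypothesis handles the `J / 2` term, this
  -- consequence the `M²` term.
  have hJ2 : J ^ 2 ≤ 8 * n := by
    have : J * J ^ 2 ≤ J * (8 * n) := by nlinarith
    exact le_of_mul_le_mul_left this hJ0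
  calc 1 / (n : ℝ) * (4 * σ ^ 2 * (J / 2 + M ^ 2 * l))
      ≤ 32 * σ ^ 2 * (1 + M) ^ 2 * (l / J ^ 2) := by
        have key : (J / 2 + M ^ 2 * l) * J ^ 2 ≤ 8 * n * ((1 + M) ^ 2 * l) := by
          have h1 : M ^ 2 * l * J ^ 2 ≤ M ^ 2 * l * (8 * n) :=
            mul_le_mul_of_nonneg_left hJ2 (by positivity)
          have h2 : 0 ≤ n * l * (1 + 2 * M) := by positivity
          nlinarith
        have h2 : (J / 2 + M ^ 2 * l) / n ≤ 8 * ((1 + M) ^ 2 * l) / J ^ 2 := by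
          rw [div_le_div_iff₀ hn' (by positivity)]
          linarith
        calc _ = 4 * σ ^ 2 * ((J / 2 + M ^ 2 * l) / n) := by ring
          _ ≤ 4 * σ ^ 2 * (8 * ((1 + M) ^ 2 * l) / J ^ 2) :=
            mul_le_mul_of_nonneg_left h2 (by positivity)
          _ = _ := by ring
    _ ≤ 32 * σ ^ 2 * (1 + M) ^ 2 * (l / ((K : ℝ) + 1) ^ 2) := by gcongr
    _ = 1 * (32 * σ ^ 2 * (1 + M) ^ 2 * (l / ((K : ℝ) + 1) ^ 2)) := by ring
    _ ≤ (1 / c₁ * (1 + η₁)) * (32 * σ ^ 2 * (1 + M) ^ 2 * (l / ((K : ℝ) + 1) ^ 2)) := by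
        refine mul_le_mul_of_nonneg_right ?_ (by positivity)
        exact one_le_mul_of_one_le_of_one_le (by rwa [one_le_div hc]) (by linarith)
    _ = _ := by ring

/-- The `J / 2` in the level absorbs the moment factor, since `√2 ≤ exp (1/2)`; the rest is exactly
`J ^ (-M²)`. -/
theorem subgaussian_tail_le (r J : ℕ) (hr : r ≤ J) (hJ : 1 ≤ J) (M σ : ℝ) (hσ : 0 < σ) :
    √2 ^ r * Real.exp (-(4 * σ ^ 2 * ((J : ℝ) / 2 + M ^ 2 * Real.log J) / (4 * σ ^ 2))) ≤
      (J : ℝ) ^ (-M ^ 2) := by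
  have hJ' : (0 : ℝ) < J := by exact_mod_cast hJ
  have h1 : √2 ≤ Real.exp (1 / 2) := by
    rw [Real.sqrt_le_left (Real.exp_pos _).le, ← Real.exp_nat_mul]
    have := Real.add_one_le_exp (1 : ℝ)
    norm_num at this ⊢
    exact this
  have h2 : √2 ^ r ≤ Real.exp ((J : ℝ) / 2) := by
    calc √2 ^ r ≤ √2 ^ J := pow_le_pow_right₀ (Real.one_le_sqrt.2 (by norm_num)) hr
      _ ≤ Real.exp (1 / 2) ^ J := pow_le_pow_left₀ (by positivity) h1 J
      _ = _ := by rw [← Real.exp_nat_mul, mul_one_div]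
  rw [mul_div_cancel_left₀ _ (by positivity), Real.rpow_def_of_pos hJ']
  calc _ ≤ Real.exp ((J : ℝ) / 2) * Real.exp (-((J : ℝ) / 2 + M ^ 2 * Real.log J)) := by gcongr
    _ = _ := by rw [← Real.exp_add]; congr 1; ring

theorem subgaussian_mse_le {K n : ℕ} {L η₁ η₂ c₁ M : ℝ} {σ : ℝ≥0} {ξ : Fin (K + 2) → ℝ}
    {x : Fin n → ℝ} {γ : Fin (K + 4) → ℝ} {Ω : Type*} [MeasurableSpace Ω] {P : Measure Ω}
    [IsProbabilityMeasure P] {ε : Fin n → Ω → ℝ} {γhat : Ω → Fin (K + 4) → ℝ} (hn : 1 ≤ n)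
    (hJ : ((K + 4 : ℕ) : ℝ) ^ 3 ≤ 8 * Real.log ((K + 4 : ℕ) : ℝ) * n)
    (h : Setup L η₁ η₂ ξ x γ) (hσ : 0 < σ) (hM : 0 ≤ M) (hc : 0 < c₁)
    (hm : ∀ i, Measurable (ε i)) (hind : iIndepFun ε P)
    (hsub : ∀ i, HasSubgaussianMGF (ε i) (σ ^ 2) P)
    (hev : ∀ ev : ℝ, Module.End.HasEigenvalue (Matrix.toLin' (gramMatrix ξ x)) ev →
      c₁ / ((K + 4 : ℕ) : ℝ) ≤ ev)
    (hfit : ∀ ω, IsMonotoneFit ξ x (fun i => spline ξ γ (x i) + ε i ω) (γhat ω)) :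
    1 - 2 * ((K + 4 : ℕ) : ℝ) ^ (-M ^ 2) ≤
      P.real {ω | mse ξ x γ (γhat ω) ≤
        approxBound L η₁ η₂ (K + 4) + noiseBound c₁ σ M η₁ (K + 4)} := by
  have hc1 := gramMatrix_eigenvalue_bound_le_one hn h hev
  obtain ⟨u, hu, hproj⟩ := exists_orthonormal_frame (fitSpace ξ x)
  set s : ℝ := 4 * (σ : ℝ) ^ 2 *
    (((K + 4 : ℕ) : ℝ) / 2 + M ^ 2 * Real.log ((K + 4 : ℕ) : ℝ)) with hs
  set bad : Set Ω := {ω | s ≤ ∑ k, (∑ i, u k i * ε i ω) ^ 2} with hbad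
  -- Only the exceptional event needs to be measurable. The event in the conclusion involves an
  -- arbitrary selection `γhat` and is reached by monotonicity of the measure.
  have hbad_meas : MeasurableSet bad := measurableSet_le measurable_const (by fun_prop)
  have hbad_le : P.real bad ≤ ((K + 4 : ℕ) : ℝ) ^ (-M ^ 2) := by
    refine (measureReal_sum_sq_ge_le hm hind hsub hσ u hu s).trans ?_
    rw [Fintype.card_fin]
    exact subgaussian_tail_le _ _ (finrank_fitSpace_le ξ x) (by omega) M σ hσ
  have hgood : badᶜ ⊆ {ω | mse ξ x γ (γhat ω) ≤
      approxBound L η₁ η₂ (K + 4) + noiseBound c₁ σ M η₁ (K + 4)} := by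
    intro ω hω
    have hω' : ∑ k, (∑ i, u k i * ε i ω) ^ 2 ≤ s := le_of_not_ge fun hle => hω hle
    have h1 := (hfit ω).sum_sq_le h.schoenberg_monotone
    have h2 := hproj (fun i => ε i ω) _ (sub_mem_fitSpace ξ x (γhat ω) (schoenberg ξ γ))
    have h3 := h.mse_schoenberg_le hn
    have h4 := noise_level_le_noiseBound (K := K) (σ := σ) hn (h.eta_nonneg hn) hc hc1 hM hJ
    have h5 : (0 : ℝ) ≤ 1 / n := by positivity
    calc mse ξ x γ (γhat ω)
        ≤ 1 / (n : ℝ) * (∑ i, (spline ξ γ (x i) - spline ξ (schoenberg ξ γ) (x i)) ^ 2 + s) :=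
          mul_le_mul_of_nonneg_left (by linarith) h5
      _ = mse ξ x γ (schoenberg ξ γ) + 1 / (n : ℝ) * s := by rw [mul_add, mse]
      _ ≤ _ := add_le_add h3 h4
  have h6 : P.real badᶜ = 1 - P.real bad := probReal_compl_eq_one_sub hbad_meas
  have h7 := measureReal_mono (μ := P) hgood
  have h8 : (0 : ℝ) ≤ ((K + 4 : ℕ) : ℝ) ^ (-M ^ 2) := by positivity
  linarith

end MonoSpline

theorem theorem1 :
    -- no error
    ((∀ (K n : ℕ) (L η₁ η₂ : ℝ) (ξ : Fin (K + 2) → ℝ) (x : Fin n → ℝ)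
        (γ γhat : Fin (K + 4) → ℝ),
        1 ≤ n →
        MonoSpline.Setup L η₁ η₂ ξ x γ →
        MonoSpline.IsMonotoneFit ξ x (fun i => MonoSpline.spline ξ γ (x i)) γhat →
        MonoSpline.mse ξ x γ γhat ≤ MonoSpline.approxBound L η₁ η₂ (K + 4)) ∧
      (∀ L η₁ η₂ : ℝ,
        (fun J : ℕ => MonoSpline.approxBound L η₁ η₂ J)
          =O[atTop] fun J : ℕ => 1 / (J : ℝ) ^ 2)) ∧
    -- independent identically distributed sub-Gaussian errors
    ((∀ c C : ℝ, 0 < c → c ≤ C →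
        ∃ N : ℕ, (C ≤ 1 → N ≤ 1) ∧
        ∀ (K n : ℕ) (L η₁ η₂ c₁ M : ℝ) (σ : ℝ≥0) (ξ : Fin (K + 2) → ℝ) (x : Fin n → ℝ)
          (γ : Fin (K + 4) → ℝ)
          (Ω : Type*) [MeasurableSpace Ω] (P : Measure Ω) [IsProbabilityMeasure P]
          (ε : Fin n → Ω → ℝ) (γhat : Ω → Fin (K + 4) → ℝ),
          1 ≤ n → N ≤ n →
          c * (n : ℝ) ^ (1 / 3 : ℝ) ≤ ((K + 4 : ℕ) : ℝ) →
          ((K + 4 : ℕ) : ℝ) ≤ C * (n : ℝ) ^ (1 / 3 : ℝ) →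
          MonoSpline.Setup L η₁ η₂ ξ x γ →
          0 < σ → 0 ≤ M → 0 < c₁ →
          (∀ i, Measurable (ε i)) →
          iIndepFun ε P →
          (∀ i j, IdentDistrib (ε i) (ε j) P P) →
          (∀ i, HasSubgaussianMGF (ε i) (σ ^ 2) P) →
          (∀ ev : ℝ, Module.End.HasEigenvalue (Matrix.toLin' (MonoSpline.gramMatrix ξ x)) ev →
            c₁ / ((K + 4 : ℕ) : ℝ) ≤ ev) →
          (∀ ω, MonoSpline.IsMonotoneFit ξ x
            (fun i => MonoSpline.spline ξ γ (x i) + ε i ω) (γhat ω)) →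
          1 - 2 * ((K + 4 : ℕ) : ℝ) ^ (-M ^ 2) ≤
            P.real {ω | MonoSpline.mse ξ x γ (γhat ω) ≤
              MonoSpline.approxBound L η₁ η₂ (K + 4) +
                MonoSpline.noiseBound c₁ σ M η₁ (K + 4)}) ∧
      (∀ L η₁ η₂ c₁ σ M : ℝ, 0 < c₁ →
        (fun J : ℕ => MonoSpline.approxBound L η₁ η₂ J + MonoSpline.noiseBound c₁ σ M η₁ J)
          =O[atTop] fun J : ℕ => Real.log (J : ℝ) / (J : ℝ) ^ 2)) := by

  refine ⟨⟨fun K n L η₁ η₂ ξ x γ γhat hn h hfit =>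
      MonoSpline.approximation_mse_le hn h hfit, MonoSpline.approxBound_isBigO⟩,
    fun c C hc _ => ?_, fun L η₁ η₂ c₁ σ M _ =>
      MonoSpline.approxBound_add_noiseBound_isBigO L η₁ η₂ c₁ σ M⟩
  obtain ⟨N, hN1, hN⟩ := MonoSpline.exists_sampleSize c C hc
  refine ⟨N, hN1, ?_⟩
  intro K n L η₁ η₂ c₁ M σ ξ x γ Ω _ P _ ε γhat hn hNn h1 h2 h hσ hM hc₁ hm hind _ hsub hev hfit
  exact MonoSpline.subgaussian_mse_le hn
    (hN n _ hNn (by push_cast; linarith [(Nat.cast_nonneg K : (0 : ℝ) ≤ K)]) h1 h2)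
    h hσ hM hc₁ hm hind hsub hev hfit
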